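/- Let $R$ be a Gorenstein local ring (a Noetherian local ring of finite injective dimension over itself) with $\dim R=1$, and let $I\subseteq R$ be an ideal containing a regular element (a non-zero-divisor of $R$). Put $S=\operatorname{End}_R(I)$, let $S/R$ denote the cokernel of the homothety map $R\to S$, let $\omega_{R/I}$ be a canonical module of $R/I$ (it is the zero module if $I=R$), let $\operatorname{tr}_R(I)\supseteq I$ be the trace ideal of $I$, that is, the image of the evaluation map $\operatorname{Hom}_R(I,R)\otimes_R I\to R$, $f\otimes x\mapsto f(x)$, and write $\lambda_R$ for the length of an $R$-module. Then all lengths below are finite, and $$\lambda_R\big(\operatorname{Ext}^1_R(I,I)\big)+\lambda_R(R/I)=\lambda_R(S/R)+\lambda_R\big((I/I^2)\otimes_{R/I}\omega_{R/I}\big).$$ In particular, $I$ is rigid, i.e. $\operatorname{Ext}^1_R(I,I)=0$, if and only if $$\lambda_R(R/I)-\lambda_R(S/R)=\lambda_R\big((I/I^2)\otimes_{R/I}\omega_{R/I}\big),$$ if and only if $$\lambda_R\big(\operatorname{tr}_R(I)/I\big)=\lambda_R\big((I/I^2)\otimes_{R}\omega_{R/I}\big).$$ -/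

import Mathlib

open CategoryTheory Abelian

universe u

/-- A Gorenstein local ring: a Noetherian local ring of finite injective dimension over itself. -/
class IsGorensteinLocalRing (R : Type u) [CommRing R] : Prop where
  isLocalRing : IsLocalRing R
  isNoetherianRing : IsNoetherianRing R
  injectiveDimension_ne_top : injectiveDimension (ModuleCat.of R R) ≠ ⊤

/-- A module `M` is rigid if `Ext¹(M, M) = 0`. -/
def IsRigidModule (R : Type u) [CommRing R] (M : Type u) [AddCommGroup M] [Module R M] : Prop :=
  Subsingleton (Ext (ModuleCat.of R M) (ModuleCat.of R M) 1)

/-- The trace of `M`: the image of the evaluation map `M* ⊗ M → R`. -/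
noncomputable def traceIdeal (R : Type u) [CommRing R] (M : Type u) [AddCommGroup M]
    [Module R M] : Ideal R :=
  LinearMap.range (contractLeft R M)

/-- The quotient `S / R` of the endomorphism ring `S = End_R(I)` by the image of the
homothety map `R → S`. -/
abbrev EndQuotient (R : Type u) [CommRing R] (I : Ideal R) : Type u :=
  Module.End R I ⧸ LinearMap.range (Algebra.linearMap R (Module.End R I))

/-- A canonical module `C` over a Noetherian ring `A`: a finitely generated module of finite
injective dimension that is maximal Cohen-Macaulay of type one at every maximal ideal `m`, i.e.
the least `i` with `Ext^i(A/m, C) ≠ 0` is `dim A_m = height m`, and that `Ext` module is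
one-dimensional over `A/m`. For a local ring `m` is the maximal ideal; over the zero ring the
zero module is canonical. -/
structure IsCanonicalModule (A : Type u) [CommRing A] (C : Type u) [AddCommGroup C]
    [Module A C] : Prop where
  finite : Module.Finite A C
  injectiveDimension_ne_top : injectiveDimension (ModuleCat.of A C) ≠ ⊤
  subsingleton_ext : ∀ m : Ideal A, m.IsMaximal → ∀ i : ℕ, (i : ℕ∞) < m.height →
    Subsingleton (Ext (ModuleCat.of A (A ⧸ m)) (ModuleCat.of A C) i)
  length_ext : ∀ m : Ideal A, m.IsMaximal → ∀ i : ℕ, (i : ℕ∞) = m.height →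
    Module.length A (Ext (ModuleCat.of A (A ⧸ m)) (ModuleCat.of A C) i) = 1

/-!
Let `x ∈ I` be regular. Finite injective dimension of `R` forces `Ext¹(R/𝔪, R)` to be simple and
`Ext²(R/𝔪, R)` to vanish for every maximal ideal `𝔪` containing `x`, so by dévissage `Ext¹(-, R)`
preserves the length of modules of finite length killed by `x`. Hence `Ext¹(I, R) = 0` and
`ℓ(I*/R) = ℓ(R/I)`. As `I*` is isomorphic to `(x) : I`, counting lengths gives
`(x) : ((x) : I) = I`, from which `End I = (tr I)*` inside `I*` and `ℓ(S/R) = ℓ(R/tr I)`.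

Applying `Hom(I, -)` to `0 → I → R → R/I → 0`, one finds that `Ext¹(I, I)` is the cokernel of
`I* → Hom(I, R/I)`, whose kernel is `End I`; since `R ⊆ End I ⊆ I*` this yields
`ℓ(Ext¹(I, I)) + ℓ(R/I) = ℓ(S/R) + ℓ(Hom(I, R/I))`. Finally `R/I = Hom(ω, ω)`, so
`Hom(I, R/I) = Hom(I/I² ⊗ ω, ω)` has the same length as `I/I² ⊗ ω` by duality over the Artinian
ring `R/I`.
-/

section ExtSequences

universe w v u'

variable {C : Type u'} [Category.{v} C] [Abelian C] [HasExt.{w} C]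
  {S : ShortComplex C} (hS : S.ShortExact) (X Y : C) {n : ℕ}

include hS

theorem subsingleton_ext_X₁ (h₂ : Subsingleton (Ext S.X₂ Y n))
    (h₃ : Subsingleton (Ext S.X₃ Y (n + 1))) : Subsingleton (Ext S.X₁ Y n) := by
  refine subsingleton_of_forall_eq 0 fun φ => ?_
  obtain ⟨ψ, rfl⟩ := Ext.contravariant_sequence_exact₁ hS Y φ (add_comm 1 n) (h₃.elim _ _)
  rw [h₂.elim ψ 0, Ext.comp_zero]

theorem subsingleton_ext_X₂ (h₁ : Subsingleton (Ext S.X₁ Y n))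
    (h₃ : Subsingleton (Ext S.X₃ Y n)) : Subsingleton (Ext S.X₂ Y n) := by
  refine subsingleton_of_forall_eq 0 fun φ => ?_
  obtain ⟨ψ, rfl⟩ := Ext.contravariant_sequence_exact₂ hS Y φ (h₁.elim _ _)
  rw [h₃.elim ψ 0, Ext.comp_zero]

theorem subsingleton_ext_X₃ (h₁ : Subsingleton (Ext S.X₁ Y n))
    (h₂ : Subsingleton (Ext S.X₂ Y (n + 1))) : Subsingleton (Ext S.X₃ Y (n + 1)) := by
  refine subsingleton_of_forall_eq 0 fun φ => ?_
  obtain ⟨ψ, rfl⟩ := Ext.contravariant_sequence_exact₃ hS Y φ (h₂.elim _ _) (add_comm 1 n)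
  rw [h₁.elim ψ 0, Ext.comp_zero]

theorem precomp_mk₀_f_surjective (h₃ : Subsingleton (Ext S.X₃ Y (n + 1))) :
    Function.Surjective ((Ext.mk₀ S.f).precomp Y (zero_add n)) := fun φ =>
  Ext.contravariant_sequence_exact₁ hS Y φ (add_comm 1 n) (h₃.elim _ _)

theorem precomp_mk₀_g_injective (h₁ : ∀ m < n, Subsingleton (Ext S.X₁ Y m)) :
    Function.Injective ((Ext.mk₀ S.g).precomp Y (zero_add n)) := by
  cases n with
  | zero =>
    have := hS.epi_g
    exact Ext.precomp_mk₀_injective_of_epi Y S.g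
  | succ n =>
    refine (injective_iff_map_eq_zero _).mpr fun φ hφ => ?_
    obtain ⟨ψ, rfl⟩ := Ext.contravariant_sequence_exact₃ hS Y φ hφ (add_comm 1 n)
    rw [(h₁ n n.lt_succ_self).elim ψ 0, Ext.comp_zero]

variable (R : Type*) [CommRing R] [Linear R C]

theorem length_ext_X₂ (h₁ : ∀ m < n, Subsingleton (Ext S.X₁ Y m))
    (h₃ : Subsingleton (Ext S.X₃ Y (n + 1))) :
    Module.length R (Ext S.X₂ Y n) =
      Module.length R (Ext S.X₃ Y n) + Module.length R (Ext S.X₁ Y n) :=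
  Module.length_eq_add_of_exact (Ext.precompOfLinear (Ext.mk₀ S.g) R Y (zero_add n))
    (Ext.precompOfLinear (Ext.mk₀ S.f) R Y (zero_add n)) (precomp_mk₀_g_injective hS Y h₁)
    (precomp_mk₀_f_surjective hS Y h₃)
    ((ShortComplex.ab_exact_iff_function_exact _).mp (Ext.contravariant_sequence_exact₂' hS Y n))

/-- The connecting homomorphism `Hom(S.X₁, Y) → Ext¹(S.X₃, Y)` of a short exact sequence `S`. -/
noncomputable def contravariantConnecting : (S.X₁ ⟶ Y) →ₗ[R] Ext S.X₃ Y 1 :=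
  Ext.precompOfLinear hS.extClass R Y (add_zero 1) ∘ₗ Ext.linearEquiv₀.symm.toLinearMap

theorem ker_contravariantConnecting :
    LinearMap.ker (contravariantConnecting hS Y R) =
      LinearMap.range (Linear.leftComp R Y S.f) := by
  ext φ
  constructor
  · intro hφ
    obtain ⟨α, hα⟩ := Ext.contravariant_sequence_exact₁ hS Y (Ext.mk₀ φ) (add_zero 1) hφ
    obtain ⟨ψ, rfl⟩ := Ext.homEquiv₀.symm.surjective α
    refine ⟨ψ, Ext.homEquiv₀.symm.injective ?_⟩
    exact (Ext.mk₀_comp_mk₀ S.f ψ).symm.trans hα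
  · rintro ⟨ψ, rfl⟩
    change hS.extClass.comp (Ext.mk₀ (S.f ≫ ψ)) (add_zero 1) = 0
    rw [← Ext.mk₀_comp_mk₀]
    exact hS.extClass_comp_assoc _

theorem contravariantConnecting_surjective (h₂ : Subsingleton (Ext S.X₂ Y 1)) :
    Function.Surjective (contravariantConnecting hS Y R) := by
  intro φ
  obtain ⟨α, rfl⟩ := Ext.contravariant_sequence_exact₃ hS Y φ (h₂.elim _ _) (add_zero 1)
  obtain ⟨ψ, rfl⟩ := Ext.homEquiv₀.symm.surjective α
  exact ⟨ψ, rfl⟩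

/-- The connecting homomorphism `Hom(X, S.X₃) → Ext¹(X, S.X₁)` of a short exact sequence `S`. -/
noncomputable def covariantConnecting : (X ⟶ S.X₃) →ₗ[R] Ext X S.X₁ 1 :=
  Ext.postcompOfLinear hS.extClass R X (zero_add 1) ∘ₗ Ext.linearEquiv₀.symm.toLinearMap

theorem ker_covariantConnecting :
    LinearMap.ker (covariantConnecting hS X R) =
      LinearMap.range (Linear.rightComp R X S.g) := by
  ext φ
  constructor
  · intro hφ
    obtain ⟨α, hα⟩ := Ext.covariant_sequence_exact₃ X hS (Ext.mk₀ φ) (zero_add 1) hφ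
    obtain ⟨ψ, rfl⟩ := Ext.homEquiv₀.symm.surjective α
    refine ⟨ψ, Ext.homEquiv₀.symm.injective ?_⟩
    exact (Ext.mk₀_comp_mk₀ ψ S.g).symm.trans hα
  · rintro ⟨ψ, rfl⟩
    change (Ext.mk₀ (ψ ≫ S.g)).comp hS.extClass (zero_add 1) = 0
    rw [← Ext.mk₀_comp_mk₀, Ext.comp_assoc_of_second_deg_zero, hS.comp_extClass, Ext.comp_zero]

theorem covariantConnecting_surjective (h₂ : Subsingleton (Ext X S.X₂ 1)) :
    Function.Surjective (covariantConnecting hS X R) := by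
  intro φ
  obtain ⟨α, rfl⟩ := Ext.covariant_sequence_exact₁ X hS φ (h₂.elim _ _) (zero_add 1)
  obtain ⟨ψ, rfl⟩ := Ext.homEquiv₀.symm.surjective α
  exact ⟨ψ, rfl⟩

omit hS in
variable {X Y} in
/-- An isomorphism in the first variable induces an isomorphism of `Ext` modules. -/
noncomputable def extLinearEquivOfIso (e : X ≅ Y) (Z : C) (n : ℕ) :
    Ext Y Z n ≃ₗ[R] Ext X Z n :=
  LinearEquiv.ofLinearMap (Ext.precompOfLinear (Ext.mk₀ e.hom) R Z (zero_add n))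
    (Ext.precompOfLinear (Ext.mk₀ e.inv) R Z (zero_add n)) (by ext; simp) (by ext; simp)

end ExtSequences

section ModuleExt

variable {R : Type u} [CommRing R]

theorem moduleCat_shortExact {N₁ N₂ N₃ : Type u} [AddCommGroup N₁] [Module R N₁]
    [AddCommGroup N₂] [Module R N₂] [AddCommGroup N₃] [Module R N₃]
    {f : N₁ →ₗ[R] N₂} {g : N₂ →ₗ[R] N₃} (hf : Function.Injective f)
    (hg : Function.Surjective g) (H : Function.Exact f g) :
    (ModuleCat.shortComplexOfCompEqZero f g H.linearMap_comp_eq_zero).ShortExact :=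
  ModuleCat.shortComplex_shortExact _ H hf hg

theorem shortExact_subtype_mkQ {M : Type u} [AddCommGroup M] [Module R M] (N : Submodule R M) :
    (ModuleCat.shortComplexOfCompEqZero N.subtype N.mkQ
      (LinearMap.exact_subtype_mkQ N).linearMap_comp_eq_zero).ShortExact :=
  moduleCat_shortExact N.injective_subtype N.mkQ_surjective (LinearMap.exact_subtype_mkQ N)

theorem shortExact_mkQ_range {M N : Type u} [AddCommGroup M] [Module R M] [AddCommGroup N]
    [Module R N] {f : M →ₗ[R] N} (hf : Function.Injective f) :
    (ModuleCat.shortComplexOfCompEqZero f (LinearMap.range f).mkQ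
      (LinearMap.exact_map_mkQ_range f).linearMap_comp_eq_zero).ShortExact :=
  moduleCat_shortExact hf (Submodule.mkQ_surjective _) (LinearMap.exact_map_mkQ_range f)

/-- `Ext⁰` of two modules is their module of homomorphisms. -/
noncomputable def extZeroLinearEquiv (M N : Type u) [AddCommGroup M] [Module R M]
    [AddCommGroup N] [Module R N] :
    Ext (ModuleCat.of R M) (ModuleCat.of R N) 0 ≃ₗ[R] (M →ₗ[R] N) :=
  Ext.linearEquiv₀ ≪≫ₗ
    ModuleCat.homLinearEquiv (S := R) (M := ModuleCat.of R M) (N := ModuleCat.of R N)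

theorem annihilator_le_annihilator_ext (M : Type u) [AddCommGroup M] [Module R M]
    (X : ModuleCat.{u} R) (n : ℕ) :
    Module.annihilator R M ≤ Module.annihilator R (Ext (ModuleCat.of R M) X n) := by
  intro a ha
  have ha' : a • 𝟙 (ModuleCat.of R M) = 0 := by
    rw [← ModuleCat.lsmul_eq_smul_id, Module.mem_annihilator_iff_lsmul_eq_zero.mp ha]
    rfl
  refine Module.mem_annihilator.mpr fun φ => ?_
  rw [← Ext.mk₀_id_comp φ, ← Ext.smul_comp, ← Ext.mk₀_smul, ha', Ext.mk₀_zero, Ext.zero_comp]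

theorem subsingleton_ext_of_subsingleton (M : Type u) [AddCommGroup M] [Module R M]
    [Subsingleton M] (X : ModuleCat.{u} R) (n : ℕ) :
    Subsingleton (Ext (ModuleCat.of R M) X n) := by
  rw [← Module.annihilator_eq_top_iff (R := R), eq_top_iff]
  exact (Module.annihilator_eq_top_iff.mpr ‹_›).ge.trans (annihilator_le_annihilator_ext M X n)

theorem subsingleton_ext_self (X : ModuleCat.{u} R) (n : ℕ) :
    Subsingleton (Ext (ModuleCat.of R R) X (n + 1)) :=
  have := ModuleCat.projective_of_free (M := ModuleCat.of R R) (Module.Basis.singleton Unit R)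
  Ext.subsingleton_of_projective (ModuleCat.of R R) X n

section Cokernel

variable {N₁ N₂ N₃ : Type u} [AddCommGroup N₁] [Module R N₁] [AddCommGroup N₂] [Module R N₂]
  [AddCommGroup N₃] [Module R N₃] {f : N₁ →ₗ[R] N₂} {g : N₂ →ₗ[R] N₃}
  (hf : Function.Injective f) (hg : Function.Surjective g) (H : Function.Exact f g)
  (M : Type u) [AddCommGroup M] [Module R M]

include hf hg H

theorem length_ext_one_eq_length_quotient_range_lcomp
    (h₂ : Subsingleton (Ext (ModuleCat.of R N₂) (ModuleCat.of R M) 1)) :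
    Module.length R (Ext (ModuleCat.of R N₃) (ModuleCat.of R M) 1) =
      Module.length R ((N₁ →ₗ[R] M) ⧸ LinearMap.range (LinearMap.lcomp R M f)) := by
  have hS := moduleCat_shortExact hf hg H
  let δ := contravariantConnecting hS (ModuleCat.of R M) R
  let e := ModuleCat.homLinearEquiv (S := R) (M := ModuleCat.of R N₁) (N := ModuleCat.of R M)
  have hker : (LinearMap.ker δ).map e.toLinearMap = LinearMap.range (LinearMap.lcomp R M f) := by
    rw [ker_contravariantConnecting]
    ext φ
    constructor
    · rintro ⟨_, ⟨ψ, rfl⟩, rfl⟩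
      exact ⟨ψ.hom, rfl⟩
    · rintro ⟨ψ, rfl⟩
      exact ⟨_, ⟨ModuleCat.ofHom ψ, rfl⟩, rfl⟩
  exact ((δ.quotKerEquivOfSurjective
    (contravariantConnecting_surjective hS _ R h₂)).symm ≪≫ₗ
      Submodule.Quotient.equiv _ _ e hker).length_eq

theorem length_ext_one_eq_length_quotient_range_compRight
    (h₂ : Subsingleton (Ext (ModuleCat.of R M) (ModuleCat.of R N₂) 1)) :
    Module.length R (Ext (ModuleCat.of R M) (ModuleCat.of R N₁) 1) =
      Module.length R ((M →ₗ[R] N₃) ⧸ LinearMap.range (LinearMap.compRight R (M := M) g)) := by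
  have hS := moduleCat_shortExact hf hg H
  let δ := covariantConnecting hS (ModuleCat.of R M) R
  let e := ModuleCat.homLinearEquiv (S := R) (M := ModuleCat.of R M) (N := ModuleCat.of R N₃)
  have hker : (LinearMap.ker δ).map e.toLinearMap =
      LinearMap.range (LinearMap.compRight R (M := M) g) := by
    rw [ker_covariantConnecting]
    ext φ
    constructor
    · rintro ⟨_, ⟨ψ, rfl⟩, rfl⟩
      exact ⟨ψ.hom, rfl⟩
    · rintro ⟨ψ, rfl⟩
      exact ⟨_, ⟨ModuleCat.ofHom ψ, rfl⟩, rfl⟩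
  exact ((δ.quotKerEquivOfSurjective
    (covariantConnecting_surjective hS _ R h₂)).symm ≪≫ₗ
      Submodule.Quotient.equiv _ _ e hker).length_eq

end Cokernel

end ModuleExt

theorem isArtinianRing_quotient {R : Type*} [CommRing R] {𝔞 : Ideal R}
    (h : IsFiniteLength R (R ⧸ 𝔞)) : IsArtinianRing (R ⧸ 𝔞) :=
  isArtinian_of_tower R (isFiniteLength_iff_isNoetherian_isArtinian.mp h).2

theorem annihilator_le_ker {R : Type*} [CommRing R] {M : Type*} [AddCommGroup M] [Module R M]
    (f : R →ₗ[R] M) : Module.annihilator R M ≤ LinearMap.ker f := fun a ha => by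
  rw [LinearMap.mem_ker, ← mul_one a, ← smul_eq_mul, map_smul]
  exact Module.mem_annihilator.mp ha _

section Devissage

variable {R : Type u} [CommRing R]

theorem exists_isMaximal_equiv_of_isSimpleModule_quotient {M : Type*} [AddCommGroup M]
    [Module R M] (N : Submodule R M) [IsSimpleModule R (M ⧸ N)] :
    ∃ 𝔪 : Ideal R, 𝔪.IsMaximal ∧ Module.annihilator R M ≤ 𝔪 ∧ Nonempty ((M ⧸ N) ≃ₗ[R] R ⧸ 𝔪) := by
  obtain ⟨𝔪, h𝔪, ⟨e⟩⟩ := isSimpleModule_iff_quot_maximal.mp ‹IsSimpleModule R (M ⧸ N)›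
  refine ⟨𝔪, h𝔪, ?_, ⟨e⟩⟩
  rw [← Ideal.annihilator_quotient (I := 𝔪)]
  exact (e.toLinearMap ∘ₗ N.mkQ).annihilator_le_of_surjective
    (e.surjective.comp N.mkQ_surjective)

theorem subsingleton_ext_of_isFiniteLength {X : ModuleCat.{u} R} {n : ℕ} {M : Type u}
    [AddCommGroup M] [Module R M] (hM : IsFiniteLength R M)
    (h : ∀ 𝔪 : Ideal R, 𝔪.IsMaximal → Module.annihilator R M ≤ 𝔪 →
      Subsingleton (Ext (ModuleCat.of R (R ⧸ 𝔪)) X n)) :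
    Subsingleton (Ext (ModuleCat.of R M) X n) := by
  induction hM with
  | @of_subsingleton M => exact subsingleton_ext_of_subsingleton M X n
  | @of_simple_quotient M _ _ N _ _ ih =>
    obtain ⟨𝔪, h𝔪, hle, ⟨e⟩⟩ := exists_isMaximal_equiv_of_isSimpleModule_quotient N
    have := h 𝔪 h𝔪 hle
    exact subsingleton_ext_X₂ (shortExact_subtype_mkQ N) X
      (ih fun 𝔭 h𝔭 hle' => h 𝔭 h𝔭 <|
        (N.subtype.annihilator_le_of_injective N.injective_subtype).trans hle')
      (extLinearEquivOfIso R e.toModuleIso X n).symm.subsingleton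

theorem subsingleton_ext_quotient_quotient {X : ModuleCat.{u} R} {n : ℕ} {𝔞 : Ideal R}
    (h𝔞 : IsFiniteLength R (R ⧸ 𝔞)) (N : Submodule R (R ⧸ 𝔞))
    (h : ∀ 𝔭 : Ideal R, 𝔭.IsMaximal → 𝔞 ≤ 𝔭 → Subsingleton (Ext (ModuleCat.of R (R ⧸ 𝔭)) X n)) :
    Subsingleton (Ext (ModuleCat.of R ((R ⧸ 𝔞) ⧸ N)) X n) := by
  refine subsingleton_ext_of_isFiniteLength (h𝔞.of_surjective N.mkQ_surjective)
    fun 𝔭 h𝔭 hle => h 𝔭 h𝔭 (Ideal.annihilator_quotient.ge.trans (le_trans ?_ hle))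
  exact N.mkQ.annihilator_le_of_surjective N.mkQ_surjective

/-- `X` is dualizing at the ideal `𝔪` in degree `d` if `Ext^i(R/𝔪, X)` vanishes for `i < d` and
for `i = d + 1`, and has length one for `i = d`. For maximal `𝔪` this prescribes the Bass numbers
of `X` at `𝔪` up to degree `d + 1`; it is what makes `Ext^d(-, X)` preserve lengths. -/
structure IsDualizingAt (X : ModuleCat.{u} R) (𝔪 : Ideal R) (d : ℕ) : Prop where
  subsingleton_ext_of_lt : ∀ i < d, Subsingleton (Ext (ModuleCat.of R (R ⧸ 𝔪)) X i)
  length_ext : Module.length R (Ext (ModuleCat.of R (R ⧸ 𝔪)) X d) = 1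
  subsingleton_ext_succ : Subsingleton (Ext (ModuleCat.of R (R ⧸ 𝔪)) X (d + 1))

theorem length_ext_eq_length {X : ModuleCat.{u} R} {d : ℕ} {M : Type u} [AddCommGroup M]
    [Module R M] (hM : IsFiniteLength R M)
    (h : ∀ 𝔪 : Ideal R, 𝔪.IsMaximal → Module.annihilator R M ≤ 𝔪 → IsDualizingAt X 𝔪 d) :
    Module.length R (Ext (ModuleCat.of R M) X d) = Module.length R M := by
  induction hM with
  | @of_subsingleton M =>
    have := subsingleton_ext_of_subsingleton M X d
    rw [Module.length_eq_zero, Module.length_eq_zero]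
  | @of_simple_quotient M _ _ N _ hN ih =>
    obtain ⟨𝔪, h𝔪, hle, ⟨e⟩⟩ := exists_isMaximal_equiv_of_isSimpleModule_quotient N
    have hdual := h 𝔪 h𝔪 hle
    have hdualN : ∀ 𝔭 : Ideal R, 𝔭.IsMaximal → Module.annihilator R N ≤ 𝔭 →
        IsDualizingAt X 𝔭 d := fun 𝔭 h𝔭 hle' =>
      h 𝔭 h𝔭 ((N.subtype.annihilator_le_of_injective N.injective_subtype).trans hle')
    have := hdual.subsingleton_ext_succ
    have hadd := length_ext_X₂ (shortExact_subtype_mkQ N) X R (n := d)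
      (fun m hm => subsingleton_ext_of_isFiniteLength hN fun 𝔭 h𝔭 hle' =>
        (hdualN 𝔭 h𝔭 hle').subsingleton_ext_of_lt m hm)
      (extLinearEquivOfIso R e.toModuleIso X (d + 1)).symm.subsingleton
    have hquot : Module.length R (Ext (ModuleCat.of R (M ⧸ N)) X d) = Module.length R (M ⧸ N) := by
      rw [← (extLinearEquivOfIso R e.toModuleIso X d).length_eq, hdual.length_ext,
        Module.length_eq_one]
    rw [Module.length_eq_add_of_exact N.subtype N.mkQ N.injective_subtype N.mkQ_surjective
      (LinearMap.exact_subtype_mkQ N), ← ih hdualN, ← hquot, add_comm]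
    exact hadd

theorem exists_injective_quotient {𝔞 𝔪 : Ideal R} (h𝔞 : IsFiniteLength R (R ⧸ 𝔞))
    (h𝔪 : 𝔪.IsMaximal) (hle : 𝔞 ≤ 𝔪) :
    ∃ f : (R ⧸ 𝔪) →ₗ[R] R ⧸ 𝔞, Function.Injective f := by
  have := isArtinianRing_quotient h𝔞
  have : IsFractionRing (R ⧸ 𝔞) (R ⧸ 𝔞) := IsFractionRing.self_iff_nonZeroDivisors_le_isUnit.mpr
    fun a ha => IsArtinianRing.isUnit_of_mem_nonZeroDivisors ha
  have hmax : (𝔪.map (Ideal.Quotient.mk 𝔞)).IsMaximal :=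
    Ideal.IsMaximal.map_of_surjective_of_ker_le Ideal.Quotient.mk_surjective (by simpa)
  obtain ⟨-, y, hy⟩ :=
    isAssociatedPrime_iff.mp (hmax.mem_associatedPrimes_of_isFractionRing (A := R ⧸ 𝔞))
  have hker : LinearMap.ker (LinearMap.toSpanSingleton R (R ⧸ 𝔞) y) = 𝔪 := by
    ext r
    rw [← Ideal.comap_map_mk hle, hy, Ideal.mem_comap, Submodule.mem_colon_singleton]
    exact LinearMap.mem_ker
  exact ⟨Submodule.liftQ 𝔪 _ hker.ge,
    LinearMap.ker_eq_bot.mp (Submodule.ker_liftQ_eq_bot' _ _ hker.symm)⟩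

theorem subsingleton_ext_of_injectiveDimension_ne_top {X : ModuleCat.{u} R}
    (hX : injectiveDimension X ≠ ⊤) {𝔞 : Ideal R} (h𝔞 : IsFiniteLength R (R ⧸ 𝔞)) {d : ℕ}
    (h : ∀ j ≥ d, Subsingleton (Ext (ModuleCat.of R (R ⧸ 𝔞)) X j)) {j : ℕ} (hj : d ≤ j)
    {𝔪 : Ideal R} (h𝔪 : 𝔪.IsMaximal) (hle : 𝔞 ≤ 𝔪) :
    Subsingleton (Ext (ModuleCat.of R (R ⧸ 𝔪)) X j) := by
  obtain ⟨n, hn⟩ := (injectiveDimension_ne_top_iff X).mp hX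
  induction hk : n + 1 - j generalizing j 𝔪 with
  | zero => exact HasInjectiveDimensionLT.subsingleton X (n + 1) j (by lia) _
  | succ k ih =>
    obtain ⟨f, hf⟩ := exists_injective_quotient h𝔞 h𝔪 hle
    exact subsingleton_ext_X₁ (shortExact_mkQ_range hf) X (h j hj)
      (subsingleton_ext_quotient_quotient h𝔞 _ fun 𝔭 h𝔭 hle' =>
        ih (by lia) h𝔭 hle' (by lia))

end Devissage

section SelfDuality

open nonZeroDivisors

variable {R : Type u} [CommRing R] {x : R}

theorem length_le_one_of_surjective {E : Type*} [AddCommGroup E] [Module R E] {g : R →ₗ[R] E}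
    (hg : Function.Surjective g) {𝔪 : Ideal R} (h𝔪 : 𝔪.IsMaximal)
    (hle : 𝔪 ≤ Module.annihilator R E) : Module.length R E ≤ 1 := by
  have : IsSimpleModule R (R ⧸ 𝔪) := isSimpleModule_iff_quot_maximal.mpr ⟨𝔪, h𝔪, ⟨.refl R _⟩⟩
  rw [← Module.length_eq_one R (R ⧸ 𝔪)]
  refine Module.length_le_of_surjective (Submodule.liftQ 𝔪 g (hle.trans (annihilator_le_ker g))) ?_
  rw [← LinearMap.range_eq_top, Submodule.range_liftQ, LinearMap.range_eq_top.mpr hg]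

theorem shortExact_mulLeft_mkQ (hx : x ∈ R⁰) :
    (ModuleCat.shortComplexOfCompEqZero (LinearMap.mulLeft R x) (Submodule.mkQ (Ideal.span {x}))
      (by ext; simp)).ShortExact := by
  refine moduleCat_shortExact (fun _ _ => (mul_cancel_left_mem_nonZeroDivisors hx).mp)
    (Submodule.mkQ_surjective _) ?_
  rw [LinearMap.exact_iff, Submodule.ker_mkQ]
  ext y
  exact Ideal.mem_span_singleton.trans ⟨fun ⟨a, ha⟩ => ⟨a, ha.symm⟩, fun ⟨a, ha⟩ => ⟨a, ha.symm⟩⟩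

theorem subsingleton_ext_quotient_span_singleton (hx : x ∈ R⁰) (X : ModuleCat.{u} R) (n : ℕ) :
    Subsingleton (Ext (ModuleCat.of R (R ⧸ Ideal.span {x})) X (n + 2)) :=
  subsingleton_ext_X₃ (shortExact_mulLeft_mkQ hx) X (subsingleton_ext_self X n)
    (subsingleton_ext_self X (n + 1))

theorem exists_surjective_ext_one_quotient_span_singleton (hx : x ∈ R⁰) :
    ∃ g : R →ₗ[R] Ext (ModuleCat.of R (R ⧸ Ideal.span {x})) (ModuleCat.of R R) 1,
      Function.Surjective g :=
  let e := (LinearMap.ringLmapEquivSelf R R R).symm ≪≫ₗ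
    (ModuleCat.homLinearEquiv (S := R) (M := ModuleCat.of R R) (N := ModuleCat.of R R)).symm
  ⟨contravariantConnecting (shortExact_mulLeft_mkQ hx) (ModuleCat.of R R) R ∘ₗ e.toLinearMap,
    (contravariantConnecting_surjective (shortExact_mulLeft_mkQ hx) _ R
      (subsingleton_ext_self _ 0)).comp e.surjective⟩

theorem subsingleton_linearMap_self_of_mem_annihilator (hx : x ∈ R⁰) {M : Type*} [AddCommGroup M]
    [Module R M] (hxM : x ∈ Module.annihilator R M) : Subsingleton (M →ₗ[R] R) :=
  IsSMulRegular.linearMap_subsingleton_of_mem_annihilator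
    (fun _ _ => (mul_cancel_left_mem_nonZeroDivisors hx).mp) hxM

variable (hx : x ∈ R⁰) (hfl : IsFiniteLength R (R ⧸ Ideal.span {x})) {𝔪 : Ideal R}
  (h𝔪 : 𝔪.IsMaximal) (hx𝔪 : x ∈ 𝔪)

include hx hfl h𝔪 hx𝔪

theorem nontrivial_ext_one_quotient :
    Nontrivial (Ext (ModuleCat.of R (R ⧸ 𝔪)) (ModuleCat.of R R) 1) := by
  by_contra! hsub
  obtain ⟨f, hf⟩ := exists_injective_quotient hfl h𝔪 ((Ideal.span_singleton_le_iff_mem 𝔪).mpr hx𝔪)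
  have hS := shortExact_mulLeft_mkQ hx
  have hmem : ModuleCat.ofHom f ∈
      LinearMap.ker (covariantConnecting hS (ModuleCat.of R (R ⧸ 𝔪)) R) := hsub.elim _ _
  rw [ker_covariantConnecting] at hmem
  obtain ⟨ψ, hψ⟩ := hmem
  have hψ0 : ψ.hom = 0 :=
    (subsingleton_linearMap_self_of_mem_annihilator hx
      (by rwa [Ideal.annihilator_quotient])).elim _ _
  have hf0 : f = 0 := by
    rw [← ModuleCat.hom_ofHom f, ← hψ]
    exact (congrArg (Submodule.mkQ (Ideal.span {x}) ∘ₗ ·) hψ0).trans (LinearMap.comp_zero _)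
  have : Nontrivial (R ⧸ 𝔪) := Ideal.Quotient.nontrivial_iff.mpr h𝔪.ne_top
  obtain ⟨a, ha⟩ := exists_ne (0 : R ⧸ 𝔪)
  exact ha (hf (by rw [hf0]; rfl))

variable (hR : injectiveDimension (ModuleCat.of R R) ≠ ⊤)

include hR

theorem subsingleton_ext_two_quotient :
    Subsingleton (Ext (ModuleCat.of R (R ⧸ 𝔪)) (ModuleCat.of R R) 2) := by
  refine subsingleton_ext_of_injectiveDimension_ne_top hR hfl (fun j hj => ?_) le_rfl h𝔪
    ((Ideal.span_singleton_le_iff_mem 𝔪).mpr hx𝔪)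
  obtain ⟨k, rfl⟩ := Nat.exists_eq_add_of_le' hj
  exact subsingleton_ext_quotient_span_singleton hx _ k

theorem length_ext_one_quotient_le_one :
    Module.length R (Ext (ModuleCat.of R (R ⧸ 𝔪)) (ModuleCat.of R R) 1) ≤ 1 := by
  obtain ⟨f, hf⟩ := exists_injective_quotient hfl h𝔪 ((Ideal.span_singleton_le_iff_mem 𝔪).mpr hx𝔪)
  have hS := shortExact_mkQ_range hf
  have hcoker : Subsingleton (Ext (ModuleCat.of R ((R ⧸ Ideal.span {x}) ⧸ LinearMap.range f))
      (ModuleCat.of R R) 2) :=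
    subsingleton_ext_quotient_quotient hfl _ fun 𝔭 h𝔭 hle =>
      subsingleton_ext_two_quotient hx hfl h𝔭 ((Ideal.span_singleton_le_iff_mem 𝔭).mp hle) hR
  obtain ⟨g, hg⟩ := exists_surjective_ext_one_quotient_span_singleton hx
  have hsurj := precomp_mk₀_f_surjective hS (ModuleCat.of R R) (n := 1) hcoker
  refine length_le_one_of_surjective
    (g := Ext.precompOfLinear (Ext.mk₀ (ModuleCat.ofHom f)) R _ (zero_add 1) ∘ₗ g)
    (hsurj.comp hg) h𝔪 ?_
  simpa only [Ideal.annihilator_quotient] using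
    annihilator_le_annihilator_ext (R ⧸ 𝔪) (ModuleCat.of R R) 1

theorem isDualizingAt_self : IsDualizingAt (ModuleCat.of R R) 𝔪 1 where
  subsingleton_ext_of_lt i hi := by
    obtain rfl : i = 0 := by lia
    have := subsingleton_linearMap_self_of_mem_annihilator hx (M := R ⧸ 𝔪)
      (by rwa [Ideal.annihilator_quotient])
    exact (extZeroLinearEquiv _ _).subsingleton
  length_ext := by
    have := nontrivial_ext_one_quotient hx hfl h𝔪 hx𝔪
    exact le_antisymm (length_ext_one_quotient_le_one hx hfl h𝔪 hx𝔪 hR)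
      (Order.one_le_iff_pos.mpr Module.length_pos)
  subsingleton_ext_succ := subsingleton_ext_two_quotient hx hfl h𝔪 hx𝔪 hR

omit h𝔪 hx𝔪

theorem length_ext_one_self {M : Type u} [AddCommGroup M] [Module R M] (hM : IsFiniteLength R M)
    (hxM : x ∈ Module.annihilator R M) :
    Module.length R (Ext (ModuleCat.of R M) (ModuleCat.of R R) 1) = Module.length R M :=
  length_ext_eq_length hM fun _ h𝔪 hle => isDualizingAt_self hx hfl h𝔪 (hle hxM) hR

theorem subsingleton_ext_two_self {M : Type u} [AddCommGroup M] [Module R M]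
    (hM : IsFiniteLength R M) (hxM : x ∈ Module.annihilator R M) :
    Subsingleton (Ext (ModuleCat.of R M) (ModuleCat.of R R) 2) :=
  subsingleton_ext_of_isFiniteLength hM fun _ h𝔪 hle =>
    subsingleton_ext_two_quotient hx hfl h𝔪 (hle hxM) hR

end SelfDuality

section Length

theorem isFiniteLength_of_finite (A : Type*) [CommRing A] [IsArtinianRing A] (N : Type*)
    [AddCommGroup N] [Module A N] [Module.Finite A N] : IsFiniteLength A N :=
  Module.length_ne_top_iff.mp Module.length_ne_top

variable {R : Type*} [Ring R] {M N : Type*} [AddCommGroup M] [Module R M] [AddCommGroup N]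
  [Module R N]

theorem length_quotient_comap_add (f : M →ₗ[R] N) {Q : Submodule R N}
    (h : Q ≤ LinearMap.range f) :
    Module.length R (M ⧸ Q.comap f) + Module.length R (N ⧸ LinearMap.range f) =
      Module.length R (N ⧸ Q) := by
  refine (Module.length_eq_add_of_exact ((Q.comap f).mapQ Q f le_rfl) (Submodule.factor h)
    ?_ (Submodule.factor_surjective h) ?_).symm
  · rw [← LinearMap.ker_eq_bot, Submodule.ker_mapQ, Submodule.mkQ_map_self]
  · rw [LinearMap.exact_iff, Submodule.range_mapQ]
    exact (Submodule.ker_mapQ _ _ _ _).trans (by rw [Submodule.comap_id])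

theorem eq_of_le_of_length_quotient_eq {P Q : Submodule R M} (h : P ≤ Q)
    (hP : Module.length R (M ⧸ P) ≠ ⊤)
    (hPQ : Module.length R (M ⧸ P) = Module.length R (M ⧸ Q)) : P = Q := by
  have hadd := length_quotient_comap_add Q.subtype (Q := P) (by rwa [Submodule.range_subtype])
  rw [Submodule.range_subtype, ← hPQ] at hadd
  have hzero := ENat.add_left_injective_of_ne_top hP (hadd.trans (zero_add _).symm)
  rw [Module.length_eq_zero_iff, Submodule.Quotient.subsingleton_iff,
    Submodule.comap_subtype_eq_top] at hzero
  exact le_antisymm h hzero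

theorem bijective_of_injective_of_length_eq {f : M →ₗ[R] N} (hf : Function.Injective f)
    (hM : Module.length R M ≠ ⊤) (h : Module.length R M = Module.length R N) :
    Function.Bijective f := by
  refine ⟨hf, ?_⟩
  have hadd := Module.length_eq_add_of_exact f (LinearMap.range f).mkQ hf
    (Submodule.mkQ_surjective _) (LinearMap.exact_map_mkQ_range f)
  rw [← h] at hadd
  have hzero : Module.length R (N ⧸ LinearMap.range f) = 0 :=
    ENat.add_right_injective_of_ne_top hM ((add_zero _).trans hadd).symm
  rw [Module.length_eq_zero_iff, Submodule.Quotient.subsingleton_iff] at hzero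
  exact LinearMap.range_eq_top.mp hzero

end Length

/-- A homomorphism `A → C` factors through `A / ann C`, so it is determined there by its value
at `1`. -/
noncomputable def quotientAnnihilatorHomEquiv (A : Type*) [CommRing A] (C : Type*) [AddCommGroup C]
    [Module A C] : ((A ⧸ Module.annihilator A C) →ₗ[A] C) ≃ₗ[A] C :=
  LinearEquiv.ofBijective (LinearMap.lcomp A C (Submodule.mkQ (Module.annihilator A C)))
      ⟨LinearMap.lcomp_injective_of_surjective _ (Submodule.mkQ_surjective _), fun φ =>
        ⟨Submodule.liftQ _ φ (annihilator_le_ker φ),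
          Submodule.liftQ_mkQ _ _ (annihilator_le_ker φ)⟩⟩ ≪≫ₗ
    LinearMap.ringLmapEquivSelf A A C

namespace IsCanonicalModule

variable {A : Type u} [CommRing A] [IsArtinianRing A] {C : Type u} [AddCommGroup C] [Module A C]
  (hC : IsCanonicalModule A C)

include hC

theorem isDualizingAt {𝔪 : Ideal A} (h𝔪 : 𝔪.IsMaximal) :
    IsDualizingAt (ModuleCat.of A C) 𝔪 0 where
  subsingleton_ext_of_lt _ hi := absurd hi (Nat.not_lt_zero _)
  length_ext := hC.length_ext 𝔪 h𝔪 0 <| by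
    rw [Nat.cast_zero, eq_comm, Ideal.height_eq_zero_iff]
    exact Ring.KrullDimLE.mem_minimalPrimes_iff.mpr ⟨h𝔪.isPrime, bot_le⟩
  subsingleton_ext_succ := by
    refine subsingleton_ext_of_injectiveDimension_ne_top hC.injectiveDimension_ne_top
      (isFiniteLength_of_finite A (A ⧸ (⊥ : Ideal A))) (fun j hj => ?_) le_rfl h𝔪 bot_le
    obtain ⟨k, rfl⟩ := Nat.exists_eq_add_of_le' hj
    have := subsingleton_ext_self (ModuleCat.of A C) k
    exact (extLinearEquivOfIso A (Submodule.quotEquivOfEqBot (⊥ : Ideal A) rfl).toModuleIso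
      _ _).symm.subsingleton

theorem length_hom_eq (N : Type u) [AddCommGroup N] [Module A N] [Module.Finite A N] :
    Module.length A (N →ₗ[A] C) = Module.length A N := by
  rw [← (extZeroLinearEquiv N C).length_eq]
  exact length_ext_eq_length (isFiniteLength_of_finite A N) fun _ h𝔪 _ => hC.isDualizingAt h𝔪

theorem length_eq : Module.length A C = Module.length A A := by
  rw [← hC.length_hom_eq A, (LinearMap.ringLmapEquivSelf A A C).length_eq]

theorem annihilator_eq_bot : Module.annihilator A C = ⊥ := by
  refine (eq_of_le_of_length_quotient_eq bot_le Module.length_ne_top ?_).symm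
  rw [(Submodule.quotEquivOfEqBot (⊥ : Ideal A) rfl).length_eq, ← hC.length_hom_eq (A ⧸ _),
    (quotientAnnihilatorHomEquiv A C).length_eq, hC.length_eq]

theorem homothety_bijective : Function.Bijective (LinearMap.lsmul A C) := by
  have := hC.finite
  refine bijective_of_injective_of_length_eq ?_ Module.length_ne_top ?_
  · rw [← LinearMap.ker_eq_bot, ← hC.annihilator_eq_bot]
    exact Submodule.ext fun _ => Module.mem_annihilator_iff_lsmul_eq_zero.symm
  · rw [hC.length_hom_eq C, hC.length_eq]

theorem length_dual_eq_length_tensorProduct (M : Type u) [AddCommGroup M] [Module A M]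
    [Module.Finite A M] :
    Module.length A (M →ₗ[A] A) = Module.length A (TensorProduct A M C) := by
  have := hC.finite
  rw [← hC.length_hom_eq (TensorProduct A M C)]
  exact (LinearEquiv.congrRight (LinearEquiv.ofBijective _ hC.homothety_bijective) ≪≫ₗ
    TensorProduct.lift.equiv (.id A) M C C).length_eq

end IsCanonicalModule

section DualIdeal

open nonZeroDivisors

variable {R : Type u} [CommRing R] {J : Ideal R}

theorem smul_apply_comm {M : Type*} [AddCommGroup M] [Module R M] (φ : J →ₗ[R] M) (y z : J) :
    (y : R) • φ z = (z : R) • φ y := by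
  rw [← map_smul, ← map_smul]
  exact congrArg φ (Subtype.ext (mul_comm (y : R) z))

theorem apply_mul_apply_comm (φ ψ : Module.Dual R J) (y z : J) : ψ y * φ z = ψ z * φ y := by
  have hsmul : ψ y • z = ψ z • y := Subtype.ext <| by
    rw [Submodule.coe_smul, Submodule.coe_smul, smul_eq_mul, mul_comm, ← smul_eq_mul,
      smul_apply_comm ψ z y, smul_eq_mul, smul_eq_mul, mul_comm]
  rw [← smul_eq_mul, ← map_smul, hsmul, map_smul, smul_eq_mul]

theorem mem_range_compRight_subtype_iff {M N : Type*} [AddCommGroup M] [Module R M]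
    [AddCommGroup N] [Module R N] {P : Submodule R N} {f : M →ₗ[R] N} :
    f ∈ LinearMap.range (LinearMap.compRight R (M := M) P.subtype) ↔ ∀ y, f y ∈ P :=
  ⟨by rintro ⟨g, rfl⟩ y; exact (g y).2, fun h => ⟨f.codRestrict P h, rfl⟩⟩

theorem range_lcomp_le_range_compRight_subtype (J : Ideal R) :
    LinearMap.range (LinearMap.lcomp R R J.subtype) ≤
      LinearMap.range (LinearMap.compRight R (M := J) J.subtype) := by
  rintro _ ⟨ψ, rfl⟩
  refine mem_range_compRight_subtype_iff.mpr fun y => ?_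
  rw [LinearMap.lcomp_apply, Submodule.subtype_apply, ← mul_one (y : R), ← smul_eq_mul, map_smul]
  exact J.mul_mem_right _ y.2

theorem comap_compRight_subtype_range_lcomp :
    (LinearMap.range (LinearMap.lcomp R R J.subtype)).comap
        (LinearMap.compRight R (M := J) J.subtype) =
      LinearMap.range (Algebra.linearMap R (Module.End R J)) := by
  ext f
  constructor
  · rintro ⟨ψ, hψ⟩
    refine ⟨ψ 1, LinearMap.ext fun y => Subtype.ext ?_⟩
    refine Eq.trans ?_ (LinearMap.congr_fun hψ y)
    rw [LinearMap.lcomp_apply, Submodule.subtype_apply, ← mul_one (y : R), ← smul_eq_mul,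
      map_smul, smul_eq_mul, mul_comm]
    rfl
  · rintro ⟨a, rfl⟩
    exact ⟨LinearMap.mulLeft R a, rfl⟩

theorem traceIdeal_le_iff {M : Type u} [AddCommGroup M] [Module R M] {K : Ideal R} :
    traceIdeal R M ≤ K ↔ ∀ (φ : Module.Dual R M) (y : M), φ y ∈ K := by
  refine ⟨fun h φ y => h ⟨φ ⊗ₜ y, contractLeft_apply φ y⟩, ?_⟩
  rintro h _ ⟨t, rfl⟩
  induction t with
  | zero => exact (map_zero (contractLeft R M)).symm ▸ K.zero_mem
  | tmul φ y => exact h φ y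
  | add s t hs ht => exact (map_add (contractLeft R M) s t).symm ▸ K.add_mem hs ht

theorem le_traceIdeal (J : Ideal R) : J ≤ traceIdeal R J := fun y hy =>
  traceIdeal_le_iff.mp le_rfl J.subtype ⟨y, hy⟩

theorem mem_colon_traceIdeal_iff {M : Type u} [AddCommGroup M] [Module R M] {K : Ideal R}
    {a : R} : a ∈ K.colon (traceIdeal R M : Set R) ↔
      ∀ (φ : Module.Dual R M) (y : M), a * φ y ∈ K :=
  Submodule.mem_colon.trans (traceIdeal_le_iff (K := Submodule.comap (LinearMap.mulLeft R a) K))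

variable {x : J} (hx : (x : R) ∈ R⁰)

include hx

theorem range_eval_eq_colon :
    LinearMap.range (Module.Dual.eval R J x) = (Ideal.span {(x : R)}).colon (J : Set R) := by
  ext a
  rw [Submodule.mem_colon]
  constructor
  · rintro ⟨φ, rfl⟩ y hy
    rw [Module.Dual.eval_apply, smul_eq_mul, mul_comm]
    exact Ideal.mem_span_singleton'.mpr
      ⟨φ ⟨y, hy⟩, (mul_comm _ _).trans (smul_apply_comm φ x ⟨y, hy⟩)⟩
  · intro ha
    let e := LinearEquiv.ofInjective (LinearMap.toSpanSingleton R R (x : R))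
      fun _ _ => (mul_cancel_right_mem_nonZeroDivisors hx).mp
    let m : J →ₗ[R] LinearMap.range (LinearMap.toSpanSingleton R R (x : R)) :=
      (LinearMap.mulLeft R a ∘ₗ J.subtype).codRestrict _
        fun y => Ideal.mem_span_singleton'.mp (ha y y.2)
    refine ⟨e.symm.toLinearMap ∘ₗ m, (mul_cancel_right_mem_nonZeroDivisors hx).mp ?_⟩
    exact congrArg Subtype.val (e.apply_symm_apply (m x))

theorem comap_eval_span_singleton :
    Submodule.comap (Module.Dual.eval R J x) (Ideal.span {(x : R)}) =
      LinearMap.range (LinearMap.lcomp R R J.subtype) := by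
  ext φ
  constructor
  · intro hφ
    obtain ⟨a, ha⟩ := Ideal.mem_span_singleton'.mp (Submodule.mem_comap.mp hφ)
    refine ⟨LinearMap.mulLeft R a, LinearMap.ext fun y => ?_⟩
    refine (mul_cancel_left_mem_nonZeroDivisors hx).mp ?_
    have hxy : (x : R) * φ y = y * (a * x) := ha ▸ smul_apply_comm φ x y
    rw [hxy, LinearMap.lcomp_apply, Submodule.subtype_apply, LinearMap.mulLeft_apply]
    ring
  · rintro ⟨ψ, rfl⟩
    refine Ideal.mem_span_singleton'.mpr ⟨ψ 1, ?_⟩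
    rw [mul_comm, ← smul_eq_mul, ← map_smul, smul_eq_mul, mul_one]
    rfl

end DualIdeal

section IdealOfRegularElement

open nonZeroDivisors

variable {R : Type u} [CommRing R] {J : Ideal R} {x : R}

theorem isFiniteLength_quotient_of_mem (hfl : IsFiniteLength R (R ⧸ Ideal.span {x}))
    (hxJ : x ∈ J) : IsFiniteLength R (R ⧸ J) :=
  hfl.of_surjective
    (Submodule.factor_surjective ((Ideal.span_singleton_le_iff_mem J).mpr hxJ))

theorem mem_colon_span_singleton (J : Ideal R) : x ∈ (Ideal.span {x}).colon (J : Set R) :=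
  Ideal.le_colon (Ideal.mem_span_singleton_self x)

variable (hR : injectiveDimension (ModuleCat.of R R) ≠ ⊤) (hx : x ∈ R⁰)
  (hfl : IsFiniteLength R (R ⧸ Ideal.span {x})) (hxJ : x ∈ J)

include hR hx hfl hxJ

theorem subsingleton_ext_one_ideal :
    Subsingleton (Ext (ModuleCat.of R J) (ModuleCat.of R R) 1) :=
  subsingleton_ext_X₁ (shortExact_subtype_mkQ J) _ (subsingleton_ext_self _ 0) <|
    subsingleton_ext_two_self hx hfl hR (isFiniteLength_quotient_of_mem hfl hxJ)
      (by rwa [Ideal.annihilator_quotient])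

theorem length_dual_quotient_range_lcomp :
    Module.length R (Module.Dual R J ⧸ LinearMap.range (LinearMap.lcomp R R J.subtype)) =
      Module.length R (R ⧸ J) := by
  rw [← length_ext_one_eq_length_quotient_range_lcomp J.injective_subtype J.mkQ_surjective
    (LinearMap.exact_subtype_mkQ J) R (subsingleton_ext_self _ 0)]
  exact length_ext_one_self hx hfl hR (isFiniteLength_quotient_of_mem hfl hxJ)
    (by rwa [Ideal.annihilator_quotient])

theorem length_quotient_add_length_quotient_colon :
    Module.length R (R ⧸ J) + Module.length R (R ⧸ (Ideal.span {x}).colon (J : Set R)) =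
      Module.length R (R ⧸ Ideal.span {x}) := by
  have hrange := range_eval_eq_colon (J := J) (x := ⟨x, hxJ⟩) hx
  have hadd := length_quotient_comap_add (Module.Dual.eval R J ⟨x, hxJ⟩) (Q := Ideal.span {x})
    (by rw [hrange]; exact Ideal.le_colon)
  rwa [comap_eval_span_singleton (x := ⟨x, hxJ⟩) hx,
    length_dual_quotient_range_lcomp hR hx hfl hxJ, hrange] at hadd

theorem colon_colon_eq :
    (Ideal.span {x}).colon ((Ideal.span {x}).colon (J : Set R) : Set R) = J := by
  have hJ := length_quotient_add_length_quotient_colon hR hx hfl hxJ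
  have hcolon := length_quotient_add_length_quotient_colon hR hx hfl
    (mem_colon_span_singleton J)
  have hle : J ≤ (Ideal.span {x}).colon ((Ideal.span {x}).colon (J : Set R) : Set R) :=
    fun y hy => Submodule.mem_colon.mpr fun a ha => by
      rw [smul_eq_mul, mul_comm]
      exact Submodule.mem_colon.mp ha y hy
  refine (eq_of_le_of_length_quotient_eq hle
    (Module.length_ne_top_iff.mpr (isFiniteLength_quotient_of_mem hfl hxJ)) ?_).symm
  refine ENat.add_left_injective_of_ne_top
    (Module.length_ne_top_iff.mpr (isFiniteLength_quotient_of_mem hfl (mem_colon_span_singleton J)))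
    (hJ.trans (hcolon.symm.trans (add_comm _ _)))

theorem range_compRight_subtype_eq_comap_colon_traceIdeal :
    LinearMap.range (LinearMap.compRight R (M := J) J.subtype) =
      Submodule.comap (Module.Dual.eval R J ⟨x, hxJ⟩)
        ((Ideal.span {x}).colon (traceIdeal R J : Set R)) := by
  ext ψ
  rw [mem_range_compRight_subtype_iff, Submodule.mem_comap, mem_colon_traceIdeal_iff]
  have hmem (y : J) : ψ y ∈ J ↔ ∀ φ : Module.Dual R J, ψ y * φ ⟨x, hxJ⟩ ∈ Ideal.span {x} := by
    refine (SetLike.ext_iff.mp (colon_colon_eq hR hx hfl hxJ) (ψ y)).symm.trans ?_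
    rw [← range_eval_eq_colon (x := ⟨x, hxJ⟩) hx, Submodule.mem_colon]
    exact Set.forall_mem_range
  -- `ψ x * φ y = ψ y * φ x`, so `ψ x ∈ (x) : tr J` says that every `ψ y` lies in `(x) : ((x) : J)`
  simp_rw [hmem, Module.Dual.eval_apply, apply_mul_apply_comm _ ψ ⟨x, hxJ⟩]
  exact forall_comm

theorem length_endQuotient_add_length_dual_quotient :
    Module.length R (EndQuotient R J) + Module.length R
        (Module.Dual R J ⧸ LinearMap.range (LinearMap.compRight R (M := J) J.subtype)) =
      Module.length R (R ⧸ J) := by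
  rw [← length_dual_quotient_range_lcomp hR hx hfl hxJ,
    ← length_quotient_comap_add _ (range_lcomp_le_range_compRight_subtype J),
    comap_compRight_subtype_range_lcomp]

theorem length_endQuotient :
    Module.length R (EndQuotient R J) = Module.length R (R ⧸ traceIdeal R J) := by
  let T := traceIdeal R J
  have hxT : x ∈ T := le_traceIdeal J hxJ
  have hrange := range_eval_eq_colon (J := J) (x := ⟨x, hxJ⟩) hx
  have hdual : Module.length R
        (Module.Dual R J ⧸ LinearMap.range (LinearMap.compRight R (M := J) J.subtype)) +
      Module.length R (R ⧸ (Ideal.span {x}).colon (J : Set R)) =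
        Module.length R (R ⧸ (Ideal.span {x}).colon (T : Set R)) := by
    rw [range_compRight_subtype_eq_comap_colon_traceIdeal hR hx hfl hxJ, ← hrange]
    exact length_quotient_comap_add _
      (hrange ▸ Submodule.colon_mono le_rfl (le_traceIdeal J))
  refine ENat.add_left_injective_of_ne_top (Module.length_ne_top_iff.mpr
    (isFiniteLength_quotient_of_mem hfl (mem_colon_span_singleton T))) ?_
  change _ + _ = _ + _
  rw [length_quotient_add_length_quotient_colon hR hx hfl hxT, ← hdual, ← add_assoc,
    length_endQuotient_add_length_dual_quotient hR hx hfl hxJ,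
    length_quotient_add_length_quotient_colon hR hx hfl hxJ]

theorem length_traceIdeal_quotient_add_length_endQuotient :
    Module.length R (traceIdeal R J ⧸ J.submoduleOf (traceIdeal R J)) +
      Module.length R (EndQuotient R J) = Module.length R (R ⧸ J) := by
  have hadd := length_quotient_comap_add (traceIdeal R J).subtype (Q := J)
    (by rw [Submodule.range_subtype]; exact le_traceIdeal J)
  rwa [Submodule.range_subtype, ← length_endQuotient hR hx hfl hxJ] at hadd

theorem length_ext_one_add_length_quotient :
    Module.length R (Ext (ModuleCat.of R J) (ModuleCat.of R J) 1) + Module.length R (R ⧸ J) =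
      Module.length R (EndQuotient R J) + Module.length R (J →ₗ[R] R ⧸ J) := by
  let π := LinearMap.compRight R (M := J) J.mkQ
  have hker : LinearMap.ker π = LinearMap.range (LinearMap.compRight R (M := J) J.subtype) := by
    ext φ
    rw [mem_range_compRight_subtype_iff, LinearMap.mem_ker, LinearMap.ext_iff]
    exact forall_congr' fun y => Submodule.Quotient.mk_eq_zero J
  have hπ := length_quotient_comap_add π (Q := ⊥) bot_le
  rw [(Submodule.quotEquivOfEqBot (⊥ : Submodule R (J →ₗ[R] R ⧸ J)) rfl).length_eq,
    Submodule.comap_bot, hker] at hπ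
  rw [length_ext_one_eq_length_quotient_range_compRight J.injective_subtype J.mkQ_surjective
    (LinearMap.exact_subtype_mkQ J) J (subsingleton_ext_one_ideal hR hx hfl hxJ), ← hπ,
    ← length_endQuotient_add_length_dual_quotient hR hx hfl hxJ]
  ac_rfl

end IdealOfRegularElement

section QuotientModule

variable {R : Type u} [CommRing R] {I : Ideal R}

/-- As `I` acts by zero on an `R / I`-module `M`, homomorphisms `I → M` factor through the conormal
module `I / I²`, which is `I.Cotangent`. -/
noncomputable def cotangentHomEquiv (M : Type*) [AddCommGroup M] [Module R M] [Module (R ⧸ I) M]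
    [IsScalarTower R (R ⧸ I) M] : (I.Cotangent →ₗ[R ⧸ I] M) ≃ₗ[R] (I →ₗ[R] M) where
  toFun φ := φ.restrictScalars R ∘ₗ I.toCotangent
  map_add' _ _ := rfl
  map_smul' _ _ := rfl
  invFun φ := (Ideal.Cotangent.lift φ fun y z => by
    change φ ((y : R) • z) = 0
    rw [map_smul, ← algebraMap_smul (R ⧸ I), Ideal.Quotient.algebraMap_eq,
      Ideal.Quotient.eq_zero_iff_mem.mpr y.2, zero_smul]).extendScalarsOfSurjective
        Ideal.Quotient.mk_surjective
  left_inv φ := LinearMap.ext fun c => by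
    obtain ⟨y, rfl⟩ := I.toCotangent_surjective c
    rfl
  right_inv _ := rfl

theorem length_tensorProduct_quotient (M N : Type*) [AddCommGroup M] [Module R M]
    [Module (R ⧸ I) M] [IsScalarTower R (R ⧸ I) M] [AddCommGroup N] [Module R N]
    [Module (R ⧸ I) N] [IsScalarTower R (R ⧸ I) N] :
    Module.length R (TensorProduct (R ⧸ I) M N) = Module.length R (TensorProduct R M N) :=
  have : TensorProduct.CompatibleSMul R (R ⧸ I) M N :=
    .of_algebraMap_surjective _ _ Ideal.Quotient.mk_surjective
  (TensorProduct.equivOfCompatibleSMul (R ⧸ I) R R M N).symm.length_eq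

theorem fg_of_isFiniteLength_quotient_span_singleton {x : R}
    (hfl : IsFiniteLength R (R ⧸ Ideal.span {x})) (hxI : x ∈ I) : I.FG := by
  have := (isFiniteLength_iff_isNoetherian_isArtinian.mp hfl).1
  refine Submodule.fg_of_fg_map_of_fg_inf_ker (Submodule.mkQ (Ideal.span {x}))
    (IsNoetherian.noetherian _) ?_
  rw [Submodule.ker_mkQ, inf_eq_right.mpr ((Ideal.span_singleton_le_iff_mem I).mpr hxI)]
  exact Submodule.fg_span_singleton x

theorem finite_cotangent (hI : I.FG) : Module.Finite (R ⧸ I) I.Cotangent :=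
  have : Module.Finite R I := .of_fg hI
  have : Module.Finite R I.Cotangent := .of_surjective I.toCotangent I.toCotangent_surjective
  .of_restrictScalars_finite R (R ⧸ I) I.Cotangent

namespace IsCanonicalModule

variable {ω : Type u} [AddCommGroup ω] [Module (R ⧸ I) ω] (hω : IsCanonicalModule (R ⧸ I) ω)
  (hRI : IsFiniteLength R (R ⧸ I)) (hI : I.FG)

include hω hRI hI

theorem length_cotangent_tensorProduct_ne_top :
    Module.length R (TensorProduct (R ⧸ I) I.Cotangent ω) ≠ ⊤ := by
  have := isArtinianRing_quotient hRI
  have := hω.finite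
  have := finite_cotangent hI
  rw [Module.length_eq_of_surjective (R := R ⧸ I) (S := R) Ideal.Quotient.mk_surjective]
  exact Module.length_ne_top

theorem length_hom_quotient :
    Module.length R (I →ₗ[R] R ⧸ I) =
      Module.length R (TensorProduct (R ⧸ I) I.Cotangent ω) := by
  have := isArtinianRing_quotient hRI
  have := finite_cotangent hI
  rw [← (cotangentHomEquiv (R ⧸ I)).length_eq,
    Module.length_eq_of_surjective (R := R ⧸ I) (S := R) Ideal.Quotient.mk_surjective,
    Module.length_eq_of_surjective (R := R ⧸ I) (S := R) Ideal.Quotient.mk_surjective]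
  exact hω.length_dual_eq_length_tensorProduct I.Cotangent

end IsCanonicalModule

end QuotientModule

theorem isRigidModule_iff_length_ext_eq_zero {R : Type u} [CommRing R] {M : Type u}
    [AddCommGroup M] [Module R M] :
    IsRigidModule R M ↔ Module.length R (Ext (ModuleCat.of R M) (ModuleCat.of R M) 1) = 0 :=
  Module.length_eq_zero_iff.symm

theorem eq_zero_iff_toNat_sub_toNat_eq {e a s h : ℕ∞} (ha : a ≠ ⊤) (hs : s ≠ ⊤) (hh : h ≠ ⊤)
    (heq : e + a = s + h) : e = 0 ↔ (a.toNat : ℤ) - (s.toNat : ℤ) = (h.toNat : ℤ) := by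
  have he : e ≠ ⊤ := (WithTop.add_ne_top.mp (heq ▸ WithTop.add_ne_top.mpr ⟨hs, hh⟩)).1
  lift e to ℕ using he
  lift a to ℕ using ha
  lift s to ℕ using hs
  lift h to ℕ using hh
  norm_cast at heq
  simp only [ENat.toNat_natCast, Nat.cast_eq_zero]
  lia

theorem eq_zero_iff_eq_of_add_eq_add {e t s h : ℕ∞} (ht : t ≠ ⊤) (hs : s ≠ ⊤)
    (heq : e + (t + s) = s + h) : e = 0 ↔ t = h := by
  have hh : e + t = h := ENat.add_right_injective_of_ne_top hs <| by
    simpa only [add_comm, add_left_comm] using heq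
  rw [← hh, eq_comm, eq_comm (a := t), ← ENat.add_left_injective_of_ne_top ht |>.eq_iff, zero_add,
    eq_comm]

theorem proposition4p8_general {R : Type u} [CommRing R]
    (hR : injectiveDimension (ModuleCat.of R R) ≠ ⊤) {x : R} (hx : x ∈ nonZeroDivisors R)
    (hfl : IsFiniteLength R (R ⧸ Ideal.span {x})) {I : Ideal R} (hxI : x ∈ I)
    {ω : Type u} [AddCommGroup ω] [Module R ω] [Module (R ⧸ I) ω] [IsScalarTower R (R ⧸ I) ω]
    (hω : IsCanonicalModule (R ⧸ I) ω) :
    (IsFiniteLength R (Ext (ModuleCat.of R I) (ModuleCat.of R I) 1) ∧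
      IsFiniteLength R (R ⧸ I) ∧
      IsFiniteLength R (EndQuotient R I) ∧
      IsFiniteLength R (TensorProduct (R ⧸ I) I.Cotangent ω) ∧
      IsFiniteLength R (TensorProduct R I.Cotangent ω) ∧
      IsFiniteLength R (traceIdeal R I ⧸ I.submoduleOf (traceIdeal R I))) ∧
    Module.length R (Ext (ModuleCat.of R I) (ModuleCat.of R I) 1) + Module.length R (R ⧸ I) =
      Module.length R (EndQuotient R I) +
        Module.length R (TensorProduct (R ⧸ I) I.Cotangent ω) ∧
    (IsRigidModule R I ↔
      ((Module.length R (R ⧸ I)).toNat : ℤ) - ((Module.length R (EndQuotient R I)).toNat : ℤ) =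
        ((Module.length R (TensorProduct (R ⧸ I) I.Cotangent ω)).toNat : ℤ)) ∧
    I ≤ traceIdeal R I ∧
    (IsRigidModule R I ↔
      Module.length R (traceIdeal R I ⧸ I.submoduleOf (traceIdeal R I)) =
        Module.length R (TensorProduct R I.Cotangent ω)) := by
  have hRI := isFiniteLength_quotient_of_mem hfl hxI
  have hI := fg_of_isFiniteLength_quotient_span_singleton hfl hxI
  have heq := length_ext_one_add_length_quotient hR hx hfl hxI
  have htr := length_traceIdeal_quotient_add_length_endQuotient hR hx hfl hxI
  rw [hω.length_hom_quotient hRI hI] at heq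
  have hten := hω.length_cotangent_tensorProduct_ne_top hRI hI
  have hRI' := Module.length_ne_top_iff.mpr hRI
  obtain ⟨ht, hs⟩ := WithTop.add_ne_top.mp (htr ▸ hRI')
  have hext := (WithTop.add_ne_top.mp (heq ▸ WithTop.add_ne_top.mpr ⟨hs, hten⟩)).1
  simp only [isRigidModule_iff_length_ext_eq_zero, ← Module.length_ne_top_iff,
    ← length_tensorProduct_quotient (I := I)]
  exact ⟨⟨hext, hRI', hs, hten, hten, ht⟩, heq, eq_zero_iff_toNat_sub_toNat_eq hRI' hs hten heq,
    le_traceIdeal I, eq_zero_iff_eq_of_add_eq_add ht hs (by rwa [htr])⟩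

theorem proposition4p8 (R : Type u) [CommRing R] [IsGorensteinLocalRing R]
    (hdim : ringKrullDim R = 1) (I : Ideal R) (hI : ∃ x ∈ I, x ∈ nonZeroDivisors R)
    (ω : Type u) [AddCommGroup ω] [Module R ω] [Module (R ⧸ I) ω] [IsScalarTower R (R ⧸ I) ω]
    (hω : IsCanonicalModule (R ⧸ I) ω) :
    -- all the modules involved have finite length
    (IsFiniteLength R (Ext (ModuleCat.of R I) (ModuleCat.of R I) 1) ∧
      IsFiniteLength R (R ⧸ I) ∧
      IsFiniteLength R (EndQuotient R I) ∧
      IsFiniteLength R (TensorProduct (R ⧸ I) I.Cotangent ω) ∧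
      IsFiniteLength R (TensorProduct R I.Cotangent ω) ∧
      IsFiniteLength R (traceIdeal R I ⧸ I.submoduleOf (traceIdeal R I))) ∧
    Module.length R (Ext (ModuleCat.of R I) (ModuleCat.of R I) 1) + Module.length R (R ⧸ I) =
      Module.length R (EndQuotient R I) +
        Module.length R (TensorProduct (R ⧸ I) I.Cotangent ω) ∧
    (IsRigidModule R I ↔
      ((Module.length R (R ⧸ I)).toNat : ℤ) - ((Module.length R (EndQuotient R I)).toNat : ℤ) =
        ((Module.length R (TensorProduct (R ⧸ I) I.Cotangent ω)).toNat : ℤ)) ∧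
    I ≤ traceIdeal R I ∧
    (IsRigidModule R I ↔
      Module.length R (traceIdeal R I ⧸ I.submoduleOf (traceIdeal R I)) =
        Module.length R (TensorProduct R I.Cotangent ω)) := by
  obtain ⟨x, hxI, hx⟩ := hI
  have := IsGorensteinLocalRing.isNoetherianRing (R := R)
  have : Ring.KrullDimLE 1 R := (Order.krullDimLE_iff _ _).mpr hdim.le
  exact proposition4p8_general IsGorensteinLocalRing.injectiveDimension_ne_top hx
    (isFiniteLength_quotient_span_singleton R hx) hxI hω
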